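/- Let $p\ge 1$ be real, $\lambda>0$, and let $\|\cdot\|=\|\cdot\|_r$ on $\mathbb{R}^m$ with $r\in\{2,p+1\}$. Put $\phi=\frac{1}{p+1}\|\cdot\|^{p+1}$ and $(\lambda\star\phi)(x)=\lambda\,\phi(\lambda^{-1}x)=\lambda^{-p}\frac{1}{p+1}\|x\|^{p+1}$. Let $\psi:\mathbb{R}^m\to\mathbb{R}\cup\{+\infty\}$ be proper, lower semicontinuous and convex, and let $Y^\star=\operatorname{argmin}\psi$. For $w\in\mathbb{R}^m$ let $$\operatorname{env}(w)=\inf_{\eta\in\mathbb{R}^m}\{\psi(\eta)+(\lambda\star\phi)(w-\eta)\},\qquad \operatorname{prox}(w)=\operatorname*{argmin}_{\eta\in\mathbb{R}^m}\{\psi(\eta)+(\lambda\star\phi)(w-\eta)\}$$ be the anisotropic Moreau envelope and the proximal point of $\psi$ at $w$. Then $\operatorname{env}$ is real-valued and the minimizer $\operatorname{prox}(w)$ exists and is unique for every $w$. Let $\varepsilon_k\ge 0$ and let $(y^k)_{k\ge 0}$ be any sequence in $\mathbb{R}^m$ such that $(\lambda\star\phi)\big(y^{k+1}-\operatorname{prox}(y^k)\big)\le\varepsilon_k$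 for all $k\ge 0$. Then the following hold. (i) For all $k\ge0$, $\operatorname{env}(y^{k+1})-\operatorname{env}(y^k)\le-(\lambda\star\phi)\big(y^k-\operatorname{prox}(y^k)\big)+\varepsilon_k$. (ii) If $\sum_k\varepsilon_k<\infty$ and $Y^\star\neq\emptyset$, then $\|y^{k+1}-y^k\|\to0$. (iii) Suppose $Y^\star$ is nonempty and bounded. If $\sum_k\varepsilon_k<\infty$, then $(y^k)$ is bounded and all of its limit points lie in $Y^\star$. Moreover, if $\varepsilon_k=\frac{c}{(k+1)^{p+1}}$ for all $k\ge0$, for some $c\ge0$, then $\beta:=\sum_{k=0}^\infty\varepsilon_k<\infty$, and for every $y^\star\in Y^\star$ the quantity $$D_\beta:=\sup\{\|y^\star-w\| : w\in\mathbb{R}^m,\ \operatorname{env}(w)\le\operatorname{env}(y^0)+\beta\}$$ is finite and, for all $k\ge1$, $$\operatorname{env}(y^k)-\operatorname{env}(y^\star)\le\frac{\lambda^{-p}D_\beta^{p+1}(p^2+p)^p+c}{k^p}.$$ -/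

import Mathlib

open Filter Topology

noncomputable section

/-- The `r`-norm `‖x‖_r` of a vector `x ∈ ℝ^m` (for real `r ≥ 1`). -/
def vecNorm {m : ℕ} (r : ℝ) (x : EuclideanSpace ℝ (Fin m)) : ℝ :=
  ‖(WithLp.toLp (ENNReal.ofReal r) x.ofLp : PiLp (ENNReal.ofReal r) (fun _ : Fin m => ℝ))‖

/-- The prox-function `φ = (1 / (p + 1)) ‖·‖_r ^ (p + 1)`. -/
def powerProx {m : ℕ} (p r : ℝ) (x : EuclideanSpace ℝ (Fin m)) : ℝ :=
  1 / (p + 1) * vecNorm r x ^ (p + 1)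

/-- The epi-scaling `(lam ⋆ φ)(x) = lam * φ (x / lam)`, for `lam > 0`. -/
def epiScale {m : ℕ} (lam : ℝ) (φ : EuclideanSpace ℝ (Fin m) → ℝ)
    (x : EuclideanSpace ℝ (Fin m)) : ℝ :=
  lam * φ (lam⁻¹ • x)

/-- The class `Γ₀(ℝ^m)` of proper, lower semicontinuous, convex functions
`ψ : ℝ^m → ℝ ∪ {+∞}`. -/
structure IsGammaZero {m : ℕ} (ψ : EuclideanSpace ℝ (Fin m) → EReal) : Prop where
  ne_bot : ∀ x, ψ x ≠ ⊥
  proper : ∃ x, ψ x ≠ ⊤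
  lsc : LowerSemicontinuous ψ
  convex : ∀ x z : EuclideanSpace ℝ (Fin m), ∀ a b : ℝ, 0 < a → 0 < b → a + b = 1 →
    ψ (a • x + b • z) ≤ (a : EReal) * ψ x + (b : EReal) * ψ z

/-- The set of global minimizers of an extended real-valued function. -/
def argminSet {m : ℕ} (f : EuclideanSpace ℝ (Fin m) → EReal) :
    Set (EuclideanSpace ℝ (Fin m)) :=
  {x | ∀ z, f x ≤ f z}

/-- The objective `η ↦ ψ η + (lam ⋆ φ)(w - η)` of the proximal subproblem at `w`. -/
def proxObjective {m : ℕ} (lam : ℝ) (φ : EuclideanSpace ℝ (Fin m) → ℝ)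
    (ψ : EuclideanSpace ℝ (Fin m) → EReal) (w η : EuclideanSpace ℝ (Fin m)) : EReal :=
  ψ η + ((epiScale lam φ (w - η) : ℝ) : EReal)

/-- The (left) anisotropic Moreau envelope
`w ↦ inf over η of ψ η + (lam ⋆ φ)(w - η)`. -/
def anisoEnv {m : ℕ} (lam : ℝ) (φ : EuclideanSpace ℝ (Fin m) → ℝ)
    (ψ : EuclideanSpace ℝ (Fin m) → EReal) (w : EuclideanSpace ℝ (Fin m)) : EReal :=
  ⨅ η, proxObjective lam φ ψ w η

/-- The anisotropic proximal point of `ψ` at `w`: the minimizer of the proximal subproblem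
(chosen by choice; existence and uniqueness of the minimizer are part of the theorem). -/
def anisoProx {m : ℕ} (lam : ℝ) (φ : EuclideanSpace ℝ (Fin m) → ℝ)
    (ψ : EuclideanSpace ℝ (Fin m) → EReal) (w : EuclideanSpace ℝ (Fin m)) :
    EuclideanSpace ℝ (Fin m) :=
  Classical.epsilon fun z => z ∈ argminSet (proxObjective lam φ ψ w)

/-- The distances `‖ystar - w‖_r` from `ystar` to the points `w` of the enlarged initial level set
`env w ≤ env y0 + β` of the anisotropic envelope. -/
def levelDistances {m : ℕ} (p r lam : ℝ) (ψ : EuclideanSpace ℝ (Fin m) → EReal)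
    (y0 ystar : EuclideanSpace ℝ (Fin m)) (β : ℝ) : Set ℝ :=
  {d | ∃ w, anisoEnv lam (powerProx p r) ψ w ≤ anisoEnv lam (powerProx p r) ψ y0 + (β : EReal) ∧
    d = vecNorm r (ystar - w)}

end

/-! ### The `r`-norm on Euclidean space -/

section vecNorm

variable {m : ℕ} {r : ℝ}

/-! Write F = `lam ⋆ φ`. F grows at least quadratically and ψ has a linear minorant, so the proximal
objective is coercive; strict convexity of F makes its minimizer unique.

Testing the envelope at `y (k+1)` with the point `prox (y k)` gives `env (y (k+1)) ≤ ψ (prox (y k))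
+ ε k`. Since `ψ (prox w) = env w - F (w - prox w)`, this is the decrease estimate. Telescoping
makes `F (y k - prox (y k))` summable, hence the steps vanish and limit points are proximal fixed
points, that is, minimizers.

For the rate, moving from the proximal point towards a minimizer gives `ψ (prox w) - min ψ ≤
lam^(-p) a^p (D - a)` with `a = ‖w - prox w‖` (`prox_gap_le`). Young's inequality turns this into a
one-step contraction with a free parameter `t` and error of order `t^(p+1)` (`prox_decrease`).
Taking `t` of order `1/k` and telescoping `k^(p+1) δ k` yields `k^(-p)`
(`le_div_rpow_of_recursion`). -/

theorem vecNorm_nonneg (r : ℝ) (hr : 1 ≤ r) (x : EuclideanSpace ℝ (Fin m)) :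
    0 ≤ vecNorm r x := by
  have : Fact (1 ≤ ENNReal.ofReal r) := ⟨by simpa using hr⟩
  exact norm_nonneg _

theorem vecNorm_add_le (hr : 1 ≤ r) (x z : EuclideanSpace ℝ (Fin m)) :
    vecNorm r (x + z) ≤ vecNorm r x + vecNorm r z := by
  have : Fact (1 ≤ ENNReal.ofReal r) := ⟨by simpa using hr⟩
  exact norm_add_le (WithLp.toLp (ENNReal.ofReal r) x.ofLp : PiLp _ (fun _ : Fin m => ℝ))
    (WithLp.toLp (ENNReal.ofReal r) z.ofLp)

theorem vecNorm_smul (hr : 1 ≤ r) (t : ℝ) (x : EuclideanSpace ℝ (Fin m)) :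
    vecNorm r (t • x) = |t| * vecNorm r x := by
  have : Fact (1 ≤ ENNReal.ofReal r) := ⟨by simpa using hr⟩
  exact norm_smul t (WithLp.toLp (ENNReal.ofReal r) x.ofLp : PiLp _ (fun _ : Fin m => ℝ))

theorem vecNorm_neg (hr : 1 ≤ r) (x : EuclideanSpace ℝ (Fin m)) :
    vecNorm r (-x) = vecNorm r x := by
  simpa using vecNorm_smul hr (-1) x

theorem vecNorm_sub_comm (hr : 1 ≤ r) (x z : EuclideanSpace ℝ (Fin m)) :
    vecNorm r (x - z) = vecNorm r (z - x) := by
  rw [← vecNorm_neg hr, neg_sub]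

theorem vecNorm_zero (hr : 1 ≤ r) : vecNorm r (0 : EuclideanSpace ℝ (Fin m)) = 0 := by
  simpa using vecNorm_smul hr 0 (0 : EuclideanSpace ℝ (Fin m))

theorem continuous_vecNorm (hr : 1 ≤ r) :
    Continuous (vecNorm r : EuclideanSpace ℝ (Fin m) → ℝ) := by
  have : Fact (1 ≤ ENNReal.ofReal r) := ⟨by simpa using hr⟩
  exact continuous_norm.comp
    ((PiLp.continuous_toLp (ENNReal.ofReal r) _).comp (PiLp.continuous_ofLp 2 _))

theorem exists_norm_le_mul_vecNorm (m : ℕ) (hr : 1 ≤ r) :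
    ∃ C : ℝ, 0 < C ∧ ∀ x : EuclideanSpace ℝ (Fin m), ‖x‖ ≤ C * vecNorm r x := by
  have : Fact (1 ≤ ENNReal.ofReal r) := ⟨by simpa using hr⟩
  let f : PiLp (ENNReal.ofReal r) (fun _ : Fin m => ℝ) →ₗ[ℝ] EuclideanSpace ℝ (Fin m) :=
    { toFun := fun x => WithLp.toLp 2 x.ofLp
      map_add' := fun _ _ => rfl
      map_smul' := fun _ _ => rfl }
  refine ⟨‖LinearMap.toContinuousLinearMap f‖ + 1, by positivity, fun x => ?_⟩
  have h := (LinearMap.toContinuousLinearMap f).le_opNorm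
    (WithLp.toLp (ENNReal.ofReal r) x.ofLp)
  have h0 := vecNorm_nonneg r hr x
  calc ‖x‖ ≤ ‖LinearMap.toContinuousLinearMap f‖ * vecNorm r x := h
    _ ≤ _ := by nlinarith

theorem vecNorm_two (x : EuclideanSpace ℝ (Fin m)) : vecNorm 2 x = ‖x‖ := by
  simp only [vecNorm]
  rw [show ENNReal.ofReal 2 = 2 by simp]

theorem vecNorm_rpow_self (hr : 0 < r) (x : EuclideanSpace ℝ (Fin m)) :
    vecNorm r x ^ r = ∑ i, |x i| ^ r := by
  have h : (ENNReal.ofReal r).toReal = r := ENNReal.toReal_ofReal hr.le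
  rw [vecNorm, PiLp.norm_eq_sum (by rw [h]; exact hr), h, ← Real.rpow_mul
    (Finset.sum_nonneg fun i _ => Real.rpow_nonneg (norm_nonneg _) _), one_div_mul_cancel hr.ne',
    Real.rpow_one]
  rfl

end vecNorm

/-! ### Strict convexity of powers of the norm -/

section strictConvexity

/-- Strictness has two sources: for equal norms, strict convexity of the norm; for different norms,
strict convexity of the scalar power. -/
theorem norm_midpoint_rpow_lt {E : Type*} [NormedAddCommGroup E] [NormedSpace ℝ E]
    [StrictConvexSpace ℝ E] {q : ℝ} (hq : 1 < q) {u v : E} (huv : u ≠ v) :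
    ‖(1 / 2 : ℝ) • (u + v)‖ ^ q < (‖u‖ ^ q + ‖v‖ ^ q) / 2 := by
  have hn : ‖(1 / 2 : ℝ) • (u + v)‖ = ‖u + v‖ / 2 := by
    rw [norm_smul]; norm_num; ring
  have htri := norm_add_le u v
  rw [hn]
  by_cases h : ‖u‖ = ‖v‖
  · have hlt : ‖u + v‖ / 2 < ‖v‖ := by
      refine lt_of_le_of_ne (by linarith) fun he => huv ?_
      have hs : SameRay ℝ u v := sameRay_iff_norm_add.2 (by linarith)
      exact hs.eq_of_norm_eq h
    have := Real.rpow_lt_rpow (by positivity) hlt (by linarith : 0 < q)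
    rw [h]; linarith
  · have hs := (strictConvexOn_rpow hq).2 (norm_nonneg u) (norm_nonneg v) h
      (by norm_num : (0 : ℝ) < 1 / 2) (by norm_num : (0 : ℝ) < 1 / 2) (by norm_num)
    simp only [smul_eq_mul] at hs
    have hle : ‖u + v‖ / 2 ≤ 1 / 2 * ‖u‖ + 1 / 2 * ‖v‖ := by linarith
    have := Real.rpow_le_rpow (by positivity) hle (by linarith : 0 ≤ q)
    linarith

variable {m : ℕ} {p r : ℝ}

/-- The two admissible `r` enter here: for `r = 2` the norm is strictly convex, while for `r = p +
1` the power is a separable sum and one differing coordinate suffices. -/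
theorem vecNorm_midpoint_rpow_lt (hp : 1 ≤ p) (hr : r = 2 ∨ r = p + 1)
    {u v : EuclideanSpace ℝ (Fin m)} (huv : u ≠ v) :
    vecNorm r ((1 / 2 : ℝ) • (u + v)) ^ (p + 1) <
      (vecNorm r u ^ (p + 1) + vecNorm r v ^ (p + 1)) / 2 := by
  rcases hr with rfl | rfl
  · simp only [vecNorm_two]
    exact norm_midpoint_rpow_lt (by linarith) huv
  · have hne : ∃ i, u i ≠ v i := by
      by_contra! h
      exact huv (PiLp.ext h)
    obtain ⟨i, hi⟩ := hne
    simp only [vecNorm_rpow_self (by linarith : 0 < p + 1)]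
    rw [← Finset.sum_add_distrib, Finset.sum_div]
    have key : ∀ j, u j ≠ v j → |((1 / 2 : ℝ) • (u + v)) j| ^ (p + 1) <
        (|u j| ^ (p + 1) + |v j| ^ (p + 1)) / 2 := fun j hj =>
      norm_midpoint_rpow_lt (E := ℝ) (by linarith : 1 < p + 1) hj
    refine Finset.sum_lt_sum (fun j _ => ?_) ⟨i, Finset.mem_univ i, key i hi⟩
    by_cases hj : u j = v j
    · have : ((1 / 2 : ℝ) • (u + v)) j = v j := by
        simp [hj]; ring
      rw [this, hj]; linarith
    · exact (key j hj).le

end strictConvexity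

/-! ### The scaled prox-function and its growth -/

section epiScale

variable {m : ℕ} {p r lam : ℝ}

theorem epiScale_powerProx (hr : 1 ≤ r) (hlam : 0 < lam) (x : EuclideanSpace ℝ (Fin m)) :
    epiScale lam (powerProx p r) x = lam ^ (-p) / (p + 1) * vecNorm r x ^ (p + 1) := by
  rw [epiScale, powerProx, vecNorm_smul hr, abs_of_pos (inv_pos.2 hlam),
    Real.mul_rpow (inv_pos.2 hlam).le (vecNorm_nonneg r hr x), Real.inv_rpow hlam.le,
    ← Real.rpow_neg hlam.le, neg_add, Real.rpow_add hlam, Real.rpow_neg_one]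
  field_simp

theorem epiScale_powerProx_nonneg (hp : 1 ≤ p) (hr : 1 ≤ r) (hlam : 0 < lam)
    (x : EuclideanSpace ℝ (Fin m)) : 0 ≤ epiScale lam (powerProx p r) x := by
  rw [epiScale_powerProx hr hlam]
  have := vecNorm_nonneg r hr x
  positivity

theorem epiScale_powerProx_zero (hp : 1 ≤ p) (hr : 1 ≤ r) (hlam : 0 < lam) :
    epiScale lam (powerProx p r) (0 : EuclideanSpace ℝ (Fin m)) = 0 := by
  rw [epiScale_powerProx hr hlam, vecNorm_zero hr, Real.zero_rpow (by linarith), mul_zero]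

theorem continuous_epiScale_powerProx (hp : 1 ≤ p) (hr : 1 ≤ r) (hlam : 0 < lam) :
    Continuous (epiScale lam (powerProx p r) : EuclideanSpace ℝ (Fin m) → ℝ) := by
  have : (epiScale lam (powerProx p r) : EuclideanSpace ℝ (Fin m) → ℝ) =
      fun x => lam ^ (-p) / (p + 1) * vecNorm r x ^ (p + 1) :=
    funext fun x => epiScale_powerProx hr hlam x
  rw [this]
  exact continuous_const.mul
    ((continuous_vecNorm hr).rpow_const fun _ => Or.inr (by linarith))

theorem epiScale_powerProx_midpoint_lt (hp : 1 ≤ p) (hr : r = 2 ∨ r = p + 1) (hlam : 0 < lam)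
    {u v : EuclideanSpace ℝ (Fin m)} (huv : u ≠ v) :
    epiScale lam (powerProx p r) ((1 / 2 : ℝ) • (u + v)) <
      (epiScale lam (powerProx p r) u + epiScale lam (powerProx p r) v) / 2 := by
  have hr1 : 1 ≤ r := by rcases hr with rfl | rfl <;> linarith
  simp only [epiScale_powerProx hr1 hlam]
  have hK : 0 < lam ^ (-p) / (p + 1) := by positivity
  have := mul_lt_mul_of_pos_left (vecNorm_midpoint_rpow_lt hp hr huv) hK
  linarith

/-- Since `p + 1 ≥ 2`, `n^(p+1) ≥ n^2 - 1` for all `n ≥ 0`; equivalence of norms does the rest. -/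
theorem exists_quadratic_le_epiScale_powerProx (m : ℕ) (hp : 1 ≤ p) (hr : 1 ≤ r)
    (hlam : 0 < lam) :
    ∃ a : ℝ, 0 < a ∧ ∃ b : ℝ, ∀ x : EuclideanSpace ℝ (Fin m),
      a * ‖x‖ ^ 2 - b ≤ epiScale lam (powerProx p r) x := by
  obtain ⟨C, hC, hb⟩ := exists_norm_le_mul_vecNorm m hr
  have hK : 0 < lam ^ (-p) / (p + 1) := by positivity
  set K := lam ^ (-p) / (p + 1) with hKdef
  refine ⟨K / C ^ 2, by positivity, K, fun x => ?_⟩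
  rw [epiScale_powerProx hr hlam, ← hKdef]
  have h0 := vecNorm_nonneg r hr x
  set n := vecNorm r x
  have h1 : n ^ 2 - 1 ≤ n ^ (p + 1) := by
    rcases le_total n 1 with h | h
    · have := Real.rpow_nonneg h0 (p + 1)
      nlinarith
    · have := Real.rpow_le_rpow_of_exponent_le h (by linarith : (2 : ℝ) ≤ p + 1)
      rw [Real.rpow_two] at this
      linarith
  have h2 : ‖x‖ ^ 2 / C ^ 2 ≤ n ^ 2 := by
    rw [div_le_iff₀ (by positivity)]
    calc ‖x‖ ^ 2 ≤ (C * n) ^ 2 := by gcongr; exact hb x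
      _ = _ := by ring
  calc K / C ^ 2 * ‖x‖ ^ 2 - K = K * (‖x‖ ^ 2 / C ^ 2 - 1) := by ring
    _ ≤ K * n ^ (p + 1) := by gcongr; linarith

end epiScale

/-! ### Growth of convex functions -/

namespace IsGammaZero

variable {m : ℕ} {ψ : EuclideanSpace ℝ (Fin m) → EReal}

theorem exists_coe (hψ : IsGammaZero ψ) {x : EuclideanSpace ℝ (Fin m)} (hx : ψ x ≠ ⊤) :
    ∃ a : ℝ, ψ x = a :=
  ⟨(ψ x).toReal, (EReal.coe_toReal hx (hψ.ne_bot x)).symm⟩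

theorem le_of_coe (hψ : IsGammaZero ψ) {x : EuclideanSpace ℝ (Fin m)} {b : EReal}
    (h : ∀ a : ℝ, ψ x = a → b ≤ a) : b ≤ ψ x := by
  by_cases hx : ψ x = ⊤
  · rw [hx]; exact le_top
  · obtain ⟨a, ha⟩ := hψ.exists_coe hx
    rw [ha]; exact h a ha

theorem convex_coe (hψ : IsGammaZero ψ) {x z : EuclideanSpace ℝ (Fin m)} {a b t : ℝ}
    (hx : ψ x = a) (hz : ψ z = b) (ht0 : 0 < t) (ht1 : t < 1) :
    ψ ((1 - t) • x + t • z) ≤ (((1 - t) * a + t * b : ℝ) : EReal) := by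
  have := hψ.convex x z (1 - t) t (by linarith) ht0 (by ring)
  rw [hx, hz] at this
  exact_mod_cast this

theorem exists_lower_bound_on_compact (hψ : IsGammaZero ψ)
    {s : Set (EuclideanSpace ℝ (Fin m))} (hs : IsCompact s) :
    ∃ M : ℝ, ∀ x ∈ s, (M : EReal) ≤ ψ x := by
  rcases s.eq_empty_or_nonempty with rfl | hne
  · exact ⟨0, by simp⟩
  · obtain ⟨x0, _, hmin⟩ := (hψ.lsc.lowerSemicontinuousOn s).exists_isMinOn hne hs
    by_cases h : ψ x0 = ⊤
    · exact ⟨0, fun x hx => le_top.trans ((h ▸ hmin hx : (⊤ : EReal) ≤ ψ x))⟩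
    · obtain ⟨a, ha⟩ := hψ.exists_coe h
      exact ⟨a, fun x hx => ha ▸ hmin hx⟩

/-- Evaluating a convex function on the unit sphere around `x` (radius `R`) bounds it outside. -/
theorem sphere_lower_bound (hψ : IsGammaZero ψ) {x z : EuclideanSpace ℝ (Fin m)} {R M a b : ℝ}
    (hR : 0 < R) (hM : ∀ u ∈ Metric.sphere x R, (M : EReal) ≤ ψ u) (hx : ψ x = a) (hz : ψ z = b)
    (hd : R ≤ ‖z - x‖) : a + (M - a) * (‖z - x‖ / R) ≤ b := by
  have hd0 : 0 < ‖z - x‖ := hR.trans_le hd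
  rcases hd.eq_or_lt with he | hlt
  · have := hM z (by rw [mem_sphere_iff_norm, he])
    rw [hz] at this
    have : M ≤ b := by exact_mod_cast this
    rw [← he, div_self hR.ne']
    linarith
  · have ht0 : 0 < R / ‖z - x‖ := by positivity
    have ht1 : R / ‖z - x‖ < 1 := (div_lt_one hd0).2 hlt
    have hc := hψ.convex_coe hx hz ht0 ht1
    have hs := hM ((1 - R / ‖z - x‖) • x + (R / ‖z - x‖) • z) (by
      rw [mem_sphere_iff_norm, show (1 - R / ‖z - x‖) • x + (R / ‖z - x‖) • z - x =
        (R / ‖z - x‖) • (z - x) by module, norm_smul, Real.norm_of_nonneg ht0.le,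
        div_mul_cancel₀ _ hd0.ne'])
    have h : M ≤ (1 - R / ‖z - x‖) * a + R / ‖z - x‖ * b := by exact_mod_cast hs.trans hc
    have h2 := mul_le_mul_of_nonneg_left h (by positivity : 0 ≤ ‖z - x‖ / R)
    have h3 : ‖z - x‖ / R * ((1 - R / ‖z - x‖) * a + R / ‖z - x‖ * b) =
        ‖z - x‖ / R * a - a + b := by
      field_simp
    rw [h3] at h2
    linarith

/-- By convexity, outside the unit ball ψ cannot fall faster than the slope from its value at the
center to a lower bound on the unit sphere. -/
theorem exists_linear_minorant (hψ : IsGammaZero ψ) {x : EuclideanSpace ℝ (Fin m)}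
    (hx : ψ x ≠ ⊤) :
    ∃ M B : ℝ, 0 ≤ B ∧ ∀ z, ((M - B * ‖z - x‖ : ℝ) : EReal) ≤ ψ z := by
  obtain ⟨a, ha⟩ := hψ.exists_coe hx
  obtain ⟨M, hM⟩ := hψ.exists_lower_bound_on_compact (isCompact_closedBall x 1)
  have hMa : M ≤ a := by
    have := hM x (by simp)
    rw [ha] at this
    exact_mod_cast this
  refine ⟨M, a - M, by linarith, fun z => hψ.le_of_coe fun b hb => ?_⟩
  norm_cast
  have hn := norm_nonneg (z - x)
  rcases le_total ‖z - x‖ 1 with h | h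
  · have := hM z (by rwa [mem_closedBall_iff_norm])
    rw [hb] at this
    have : M ≤ b := by exact_mod_cast this
    nlinarith
  · have := hψ.sphere_lower_bound one_pos
      (fun u hu => hM u (Metric.sphere_subset_closedBall hu)) ha hb h
    rw [div_one] at this
    linarith

/-- On a sphere enclosing the minimizers, compactness puts ψ strictly above its minimum; convexity
propagates this gap outwards as linear growth. -/
theorem exists_sublevel_radius (hψ : IsGammaZero ψ) {x : EuclideanSpace ℝ (Fin m)}
    (hx : x ∈ argminSet ψ) (hb : Bornology.IsBounded (argminSet ψ)) (L : ℝ) :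
    ∃ R : ℝ, ∀ z, ∀ b : ℝ, ψ z = b → b ≤ L → ‖z - x‖ ≤ R := by
  obtain ⟨x0, hx0⟩ := hψ.proper
  obtain ⟨a, ha⟩ := hψ.exists_coe (ne_top_of_le_ne_top hx0 (hx x0))
  obtain ⟨R, hR0, hR⟩ := hb.subset_ball_lt 0 x
  have hM : ∃ M : ℝ, a < M ∧ ∀ u ∈ Metric.sphere x R, (M : EReal) ≤ ψ u := by
    rcases (Metric.sphere x R).eq_empty_or_nonempty with he | hne
    · exact ⟨a + 1, by linarith, by simp [he]⟩
    · obtain ⟨u, hu, hmin⟩ :=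
        (hψ.lsc.lowerSemicontinuousOn _).exists_isMinOn hne (isCompact_sphere x R)
      have hlt : (a : EReal) < ψ u := by
        refine lt_of_not_ge fun hle => ?_
        have : u ∈ argminSet ψ := fun z => (ha ▸ hle).trans (hx z)
        exact (Metric.mem_ball.1 (hR this)).ne (Metric.mem_sphere.1 hu)
      obtain ⟨M, h1, h2⟩ := EReal.lt_iff_exists_real_btwn.1 hlt
      exact ⟨M, by exact_mod_cast h1, fun v hv => h2.le.trans (hmin hv)⟩
  obtain ⟨M, haM, hM⟩ := hM
  refine ⟨max R ((L - a) / (M - a) * R), fun z b hz hbL => ?_⟩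
  rcases le_total ‖z - x‖ R with h | h
  · exact h.trans (le_max_left _ _)
  · refine le_trans ?_ (le_max_right _ _)
    have := hψ.sphere_lower_bound hR0 hM ha hz h
    rw [← div_le_iff₀ hR0, le_div_iff₀ (by linarith)]
    linarith

end IsGammaZero

/-! ### Existence and uniqueness of the proximal point -/

section prox

variable {m : ℕ} {p r lam : ℝ} {ψ : EuclideanSpace ℝ (Fin m) → EReal}

theorem IsGammaZero.lowerSemicontinuous_proxObjective (hψ : IsGammaZero ψ)
    {φ : EuclideanSpace ℝ (Fin m) → ℝ} (hφ : Continuous (epiScale lam φ))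
    (w : EuclideanSpace ℝ (Fin m)) : LowerSemicontinuous (proxObjective lam φ ψ w) := by
  refine hψ.lsc.add' ?_ fun x => EReal.continuousAt_add (Or.inr (EReal.coe_ne_bot _))
    (Or.inl (hψ.ne_bot x))
  exact (continuous_coe_real_ereal.comp (hφ.comp (by fun_prop))).lowerSemicontinuous

theorem IsGammaZero.exists_mem_argminSet_proxObjective (hψ : IsGammaZero ψ) (hp : 1 ≤ p)
    (hr : 1 ≤ r) (hlam : 0 < lam) (w : EuclideanSpace ℝ (Fin m)) :
    ∃ z, z ∈ argminSet (proxObjective lam (powerProx p r) ψ w) := by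
  obtain ⟨x, hx⟩ := hψ.proper
  obtain ⟨α, hα⟩ := hψ.exists_coe hx
  obtain ⟨M, B, hB, hlow⟩ := hψ.exists_linear_minorant hx
  obtain ⟨a, ha, b, hquad⟩ := exists_quadratic_le_epiScale_powerProx m hp hr hlam
  set F := epiScale lam (powerProx p r) with hF
  set W := ‖w - x‖ with hW
  -- With `u = ‖z - x‖ - W`, the point `z` is no better than `x` once `c ≤ u * (a * u - B)`; `R`
  -- forces `u > 1` and `a * u > B + |c| + 1`.
  set c := B * W - M + b + (α + F (w - x)) with hc
  set R := W + 1 + (B + |c| + 1) / a with hR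
  have hfar : ∀ z, R < ‖z - x‖ →
      proxObjective lam (powerProx p r) ψ w x ≤ proxObjective lam (powerProx p r) ψ w z := by
    intro z hz
    by_cases hzt : ψ z = ⊤
    · simp only [proxObjective, hzt, EReal.top_add_coe, le_top]
    obtain ⟨β, hβ⟩ := hψ.exists_coe hzt
    simp only [proxObjective, hα, hβ]
    norm_cast
    have h1 : M - B * ‖z - x‖ ≤ β := by
      have := hlow z
      rw [hβ] at this
      exact_mod_cast this
    have h2 := hquad (w - z)
    have h3 : ‖z - x‖ - W ≤ ‖w - z‖ := by
      have := norm_sub_le (w - x) (w - z)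
      rw [show w - x - (w - z) = z - x by abel] at this
      linarith
    set u := ‖z - x‖ - W
    have hu : 1 + (B + |c| + 1) / a < u := by simp only [u]; linarith
    have hcab := le_abs_self c
    have hcab0 := abs_nonneg c
    have hpos : 0 ≤ (B + |c| + 1) / a := by positivity
    have hau : B + |c| + 1 < a * u := by
      have h5 : (B + |c| + 1) / a < u := by linarith
      rwa [div_lt_iff₀' ha] at h5
    have h4 : a * u ^ 2 ≤ a * ‖w - z‖ ^ 2 := by
      have : 0 ≤ u := by linarith
      gcongr
    have h6 : c ≤ u * (a * u - B) := by nlinarith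
    have h7 : B * ‖z - x‖ = B * u + B * W := by simp only [u]; ring
    rw [← hF]
    nlinarith
  have hxmem : x ∈ Metric.closedBall x R := by
    have : 0 ≤ R := by positivity
    simpa using this
  obtain ⟨z, _, hmin⟩ := ((hψ.lowerSemicontinuous_proxObjective
    (continuous_epiScale_powerProx hp hr hlam) w).lowerSemicontinuousOn _).exists_isMinOn
      ⟨x, hxmem⟩ (isCompact_closedBall x R)
  refine ⟨z, fun v => ?_⟩
  by_cases hv : ‖v - x‖ ≤ R
  · exact hmin (mem_closedBall_iff_norm.2 hv)
  · exact (hmin hxmem).trans (hfar v (not_le.1 hv))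

theorem IsGammaZero.psi_ne_top_of_mem_argminSet_proxObjective (hψ : IsGammaZero ψ)
    {φ : EuclideanSpace ℝ (Fin m) → ℝ} {w z : EuclideanSpace ℝ (Fin m)}
    (hz : z ∈ argminSet (proxObjective lam φ ψ w)) : ψ z ≠ ⊤ := by
  intro h
  obtain ⟨x, hx⟩ := hψ.proper
  obtain ⟨α, hα⟩ := hψ.exists_coe hx
  have := hz x
  simp only [proxObjective, h, hα, EReal.top_add_coe, top_le_iff] at this
  exact EReal.coe_ne_top _ (by exact_mod_cast this)

theorem IsGammaZero.argminSet_proxObjective_subsingleton (hψ : IsGammaZero ψ) (hp : 1 ≤ p)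
    (hr : r = 2 ∨ r = p + 1) (hlam : 0 < lam) (w : EuclideanSpace ℝ (Fin m)) :
    (argminSet (proxObjective lam (powerProx p r) ψ w)).Subsingleton := by
  intro x hx z hz
  by_contra hne
  obtain ⟨α, hα⟩ := hψ.exists_coe (hψ.psi_ne_top_of_mem_argminSet_proxObjective hx)
  obtain ⟨β, hβ⟩ := hψ.exists_coe (hψ.psi_ne_top_of_mem_argminSet_proxObjective hz)
  have hlt := epiScale_powerProx_midpoint_lt hp hr hlam
    (u := w - x) (v := w - z) (by simpa using hne)
  have hc := hψ.convex_coe hα hβ (t := 1 / 2) (by norm_num) (by norm_num)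
  set v := (1 - 1 / 2 : ℝ) • x + (1 / 2 : ℝ) • z
  obtain ⟨γ, hγ⟩ := hψ.exists_coe (ne_top_of_le_ne_top (EReal.coe_ne_top _) hc)
  have h1 := hx v
  have h2 := hz v
  simp only [proxObjective, hα, hβ, hγ] at h1 h2
  rw [hγ] at hc
  norm_cast at h1 h2 hc
  rw [show (1 / 2 : ℝ) • (w - x + (w - z)) = w - v by simp only [v]; module] at hlt
  linarith

theorem IsGammaZero.anisoProx_mem (hψ : IsGammaZero ψ) (hp : 1 ≤ p)
    (hr : 1 ≤ r) (hlam : 0 < lam) (w : EuclideanSpace ℝ (Fin m)) :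
    anisoProx lam (powerProx p r) ψ w ∈ argminSet (proxObjective lam (powerProx p r) ψ w) :=
  Classical.epsilon_spec (hψ.exists_mem_argminSet_proxObjective hp hr hlam w)

theorem anisoEnv_eq_of_mem {φ : EuclideanSpace ℝ (Fin m) → ℝ} {w z : EuclideanSpace ℝ (Fin m)}
    (hz : z ∈ argminSet (proxObjective lam φ ψ w)) :
    anisoEnv lam φ ψ w = proxObjective lam φ ψ w z :=
  le_antisymm (iInf_le _ z) (le_iInf hz)

/-- Real-valued descriptions `e` of the envelope and `s` of `ψ` at the proximal points. -/
theorem IsGammaZero.exists_real_env (hψ : IsGammaZero ψ) (hp : 1 ≤ p)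
    (hr : 1 ≤ r) (hlam : 0 < lam) :
    ∃ e s : EuclideanSpace ℝ (Fin m) → ℝ,
      (∀ w, anisoEnv lam (powerProx p r) ψ w = e w) ∧
      (∀ w, ψ (anisoProx lam (powerProx p r) ψ w) = s w) ∧
      (∀ w, e w = s w +
        epiScale lam (powerProx p r) (w - anisoProx lam (powerProx p r) ψ w)) ∧
      ∀ w z, ∀ b : ℝ, ψ z = b → e w ≤ b + epiScale lam (powerProx p r) (w - z) := by
  have hmem := hψ.anisoProx_mem hp hr hlam
  choose s hs using fun w =>
    hψ.exists_coe (hψ.psi_ne_top_of_mem_argminSet_proxObjective (hmem w))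
  have he : ∀ w, anisoEnv lam (powerProx p r) ψ w = ((s w +
      epiScale lam (powerProx p r) (w - anisoProx lam (powerProx p r) ψ w) : ℝ) : EReal) := by
    intro w
    rw [anisoEnv_eq_of_mem (hmem w), proxObjective, hs]
    norm_cast
  refine ⟨_, s, he, hs, fun w => rfl, fun w z b hb => ?_⟩
  have h : anisoEnv lam (powerProx p r) ψ w ≤ proxObjective lam (powerProx p r) ψ w z :=
    iInf_le _ z
  rw [he, proxObjective, hb] at h
  exact_mod_cast h

end prox

/-! ### Scalar inequalities behind the rate -/

section rate

/-- Weighted AM-GM; the factors `1 / p` and `p ^ p` cancel in the geometric mean and leave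
coefficient one on `a ^ (p + 1)`, as `prox_decrease` needs. -/
theorem weighted_young {p a b : ℝ} (hp : 0 < p) (ha : 0 ≤ a) (hb : 0 ≤ b) :
    (p + 1) * (a ^ p * b) ≤ a ^ (p + 1) + p ^ p * b ^ (p + 1) := by
  have hp1 : 0 < p + 1 := by linarith
  have h := Real.geom_mean_le_arith_mean2_weighted (w₁ := p / (p + 1)) (w₂ := 1 / (p + 1))
    (p₁ := a ^ (p + 1) / p) (p₂ := p ^ p * b ^ (p + 1)) (by positivity) (by positivity)
    (by positivity) (by positivity) (by field_simp)
  have e1 : (a ^ (p + 1) / p) ^ (p / (p + 1)) = a ^ p / p ^ (p / (p + 1)) := by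
    rw [Real.div_rpow (by positivity) hp.le, ← Real.rpow_mul ha, mul_div_cancel₀ _ hp1.ne']
  have e2 : (p ^ p * b ^ (p + 1)) ^ (1 / (p + 1)) = p ^ (p / (p + 1)) * b := by
    rw [Real.mul_rpow (by positivity) (by positivity), ← Real.rpow_mul hp.le, ← Real.rpow_mul hb,
      mul_one_div_cancel hp1.ne', Real.rpow_one, mul_one_div]
  have hpp : 0 < p ^ (p / (p + 1)) := by positivity
  have e3 : a ^ p / p ^ (p / (p + 1)) * (p ^ (p / (p + 1)) * b) = a ^ p * b := by
    field_simp
  have e4 : p / (p + 1) * (a ^ (p + 1) / p) + 1 / (p + 1) * (p ^ p * b ^ (p + 1)) =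
      (a ^ (p + 1) + p ^ p * b ^ (p + 1)) / (p + 1) := by
    field_simp
  rw [e1, e2, e3, e4, le_div_iff₀ hp1] at h
  linarith

theorem le_div_rpow_of_recursion {p C c : ℝ} (hp : 1 ≤ p) (hC : 0 ≤ C) {δ : ℕ → ℝ}
    (h : ∀ (k : ℕ) (t : ℝ), 0 ≤ t →
      δ (k + 1) ≤ (1 - t) * δ k + C * t ^ (p + 1) + c / ((k : ℝ) + 1) ^ (p + 1))
    {k : ℕ} (hk : 1 ≤ k) : δ k ≤ (C * (p + 1) ^ (p + 1) + c) / (k : ℝ) ^ p := by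
  have key : ∀ k : ℕ, (k : ℝ) ^ (p + 1) * δ k ≤ k * (C * (p + 1) ^ (p + 1) + c) := by
    intro k
    induction k with
    | zero => simp [Real.zero_rpow (by linarith : p + 1 ≠ 0)]
    | succ k ih =>
      have hn : (0 : ℝ) < (k : ℝ) + 1 := by positivity
      set n : ℝ := (k : ℝ) + 1 with hndef
      have hq1 : ((k : ℝ) / n) ^ (p + 1) ≤ 1 :=
        Real.rpow_le_one (by positivity) ((div_le_one hn).2 (by linarith)) (by linarith)
      have hbern : 1 - ((k : ℝ) / n) ^ (p + 1) ≤ (p + 1) / n := by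
        have := one_add_mul_self_le_rpow_one_add (s := -1 / n) (p := p + 1)
          (by rw [le_div_iff₀ hn]; have : (0 : ℝ) ≤ k := k.cast_nonneg; linarith) (by linarith)
        rw [show 1 + -1 / n = (k : ℝ) / n by field_simp; linarith] at this
        have e : (p + 1) * (-1 / n) = -((p + 1) / n) := by ring
        linarith
      -- This `t` makes `(1 - t) * n^(p+1)` equal to `k^(p+1)`, so the scaled recursion telescopes
      -- whatever the sign of `δ k`; Bernoulli gives `t ≤ (p+1)/n`.
      have hrec := h k (1 - ((k : ℝ) / n) ^ (p + 1)) (by linarith)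
      have ht : (1 - ((k : ℝ) / n) ^ (p + 1)) ^ (p + 1) ≤ ((p + 1) / n) ^ (p + 1) :=
        Real.rpow_le_rpow (by linarith) hbern (by linarith)
      have hq : ((k : ℝ) / n) ^ (p + 1) = (k : ℝ) ^ (p + 1) / n ^ (p + 1) :=
        Real.div_rpow (by positivity) hn.le _
      rw [hq, Real.div_rpow (by linarith) hn.le] at ht
      rw [sub_sub_cancel, hq, ← hndef] at hrec
      have hnp : 0 < n ^ (p + 1) := by positivity
      have h1 := mul_le_mul_of_nonneg_left hrec hnp.le
      have h2 := mul_le_mul_of_nonneg_left (mul_le_mul_of_nonneg_left ht hC) hnp.le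
      have e1 : n ^ (p + 1) * (C * ((p + 1) ^ (p + 1) / n ^ (p + 1))) = C * (p + 1) ^ (p + 1) := by
        field_simp
      have e2 : n ^ (p + 1) * ((k : ℝ) ^ (p + 1) / n ^ (p + 1) * δ k) = (k : ℝ) ^ (p + 1) * δ k := by
        field_simp
      have e3 : n ^ (p + 1) * (c / n ^ (p + 1)) = c := by field_simp
      push_cast
      rw [← hndef]
      rw [mul_add, mul_add, e2, e3] at h1
      rw [e1] at h2
      have : n * (C * (p + 1) ^ (p + 1) + c) =
        k * (C * (p + 1) ^ (p + 1) + c) + (C * (p + 1) ^ (p + 1) + c) := by rw [hndef]; ring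
      linarith
  have hk0 : (0 : ℝ) < k := by exact_mod_cast hk
  have := key k
  rw [Real.rpow_add_one hk0.ne'] at this
  rw [le_div_iff₀ (by positivity)]
  refine le_of_mul_le_mul_left ?_ hk0
  linarith

end rate

/-! ### One-step estimates at a proximal point -/

section proxGap

variable {m : ℕ} {p r lam : ℝ} {ψ : EuclideanSpace ℝ (Fin m) → EReal}

theorem tendsto_vecNorm_of_tendsto_epiScale (hp : 1 ≤ p) (hr : 1 ≤ r) (hlam : 0 < lam)
    {ι : Type*} {l : Filter ι} {u : ι → EuclideanSpace ℝ (Fin m)}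
    (h : Tendsto (fun k => epiScale lam (powerProx p r) (u k)) l (𝓝 0)) :
    Tendsto (fun k => vecNorm r (u k)) l (𝓝 0) := by
  have hK : 0 < lam ^ (-p) / (p + 1) := by positivity
  have hp1 : 0 < p + 1 := by linarith
  have h2 := ((h.div_const (lam ^ (-p) / (p + 1))).rpow_const (p := (p + 1)⁻¹)
    (Or.inr (by positivity)))
  rw [zero_div, Real.zero_rpow (by positivity)] at h2
  refine h2.congr fun k => ?_
  rw [epiScale_powerProx hr hlam, mul_div_cancel_left₀ _ hK.ne',
    ← Real.rpow_mul (vecNorm_nonneg r hr _), mul_inv_cancel₀ hp1.ne', Real.rpow_one]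

/-- First-order estimate at a minimizer `x` of the proximal subproblem at `w`. -/
theorem IsGammaZero.prox_gap_le (hψ : IsGammaZero ψ) (hp : 1 ≤ p) (hr : 1 ≤ r) (hlam : 0 < lam)
    {w x z : EuclideanSpace ℝ (Fin m)} {α b D : ℝ} (hx : ψ x = α) (hz : ψ z = b)
    (hmin : ∀ v, ∀ c : ℝ, ψ v = c → α + epiScale lam (powerProx p r) (w - x) ≤
      c + epiScale lam (powerProx p r) (w - v))
    (hD : vecNorm r (w - z) ≤ D) :
    α - b ≤ lam ^ (-p) * (vecNorm r (w - x) ^ p * (D - vecNorm r (w - x))) := by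
  have hK : 0 < lam ^ (-p) / (p + 1) := by positivity
  have hp1 : 0 < p + 1 := by linarith
  have ha := vecNorm_nonneg r hr (w - x)
  set a := vecNorm r (w - x) with hadef
  set K := lam ^ (-p) / (p + 1) with hKdef
  have hD0 : 0 ≤ D := (vecNorm_nonneg r hr _).trans hD
  -- Minimality of `x` is tested against the segment point `(1 - t) • x + t • z`; convexity of ψ
  -- leaves a difference quotient.
  have hstep : ∀ t : ℝ, 0 < t → t < 1 →
      α - b ≤ t⁻¹ * (K * (a + t * (D - a)) ^ (p + 1) - K * a ^ (p + 1)) := by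
    intro t ht0 ht1
    have hc := hψ.convex_coe hx hz ht0 ht1
    obtain ⟨γ, hγ⟩ := hψ.exists_coe (ne_top_of_le_ne_top (EReal.coe_ne_top _) hc)
    have h1 := hmin _ γ hγ
    rw [hγ] at hc
    norm_cast at hc
    rw [epiScale_powerProx hr hlam, epiScale_powerProx hr hlam, ← hKdef, ← hadef] at h1
    have h2 : vecNorm r (w - ((1 - t) • x + t • z)) ≤ a + t * (D - a) := by
      rw [show w - ((1 - t) • x + t • z) = (1 - t) • (w - x) + t • (w - z) by module]
      refine (vecNorm_add_le hr _ _).trans ?_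
      rw [vecNorm_smul hr, vecNorm_smul hr, abs_of_pos ht0, abs_of_pos (by linarith : 0 < 1 - t)]
      have := mul_le_mul_of_nonneg_left hD ht0.le
      linarith
    have h3 := mul_le_mul_of_nonneg_left
      (Real.rpow_le_rpow (vecNorm_nonneg r hr _) h2 hp1.le) hK.le
    rw [le_inv_mul_iff₀ ht0]
    linarith
  -- The exponent `p + 1 ≥ 1` keeps the power differentiable even when `a = 0`, so letting `t → 0+`
  -- is always allowed.
  have hder : HasDerivAt (fun t : ℝ => K * (a + t * (D - a)) ^ (p + 1))
      (lam ^ (-p) * (a ^ p * (D - a))) 0 := by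
    have h1 : HasDerivAt (fun t : ℝ => a + t * (D - a)) (D - a) 0 := by
      simpa using ((hasDerivAt_id (0 : ℝ)).mul_const (D - a)).const_add a
    have h2 := (h1.rpow_const (p := p + 1) (Or.inr (by linarith))).const_mul K
    refine h2.congr_deriv ?_
    rw [zero_mul, add_zero, add_sub_cancel_right, hKdef]
    field_simp
  refine ge_of_tendsto hder.tendsto_slope_zero_right ?_
  filter_upwards [Ioo_mem_nhdsGT (one_pos : (0 : ℝ) < 1)] with t ht
  simpa using hstep t ht.1 ht.2

/-- The gap estimate bounds `env w - b` by `lam^(-p) a^p D`. After multiplication by `t`, Young's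
inequality for `a` and `t * D` produces exactly `F (w - x)`, the amount by which ψ at `x` lies below
the envelope. -/
theorem IsGammaZero.prox_decrease (hψ : IsGammaZero ψ) (hp : 1 ≤ p) (hr : 1 ≤ r) (hlam : 0 < lam)
    {w x z : EuclideanSpace ℝ (Fin m)} {α b D t : ℝ} (hx : ψ x = α) (hz : ψ z = b)
    (hmin : ∀ v, ∀ c : ℝ, ψ v = c → α + epiScale lam (powerProx p r) (w - x) ≤
      c + epiScale lam (powerProx p r) (w - v))
    (hD : vecNorm r (w - z) ≤ D) (ht : 0 ≤ t) :
    α - b ≤ (1 - t) * (α + epiScale lam (powerProx p r) (w - x) - b) +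
      lam ^ (-p) / (p + 1) * p ^ p * D ^ (p + 1) * t ^ (p + 1) := by
  have hgap := hψ.prox_gap_le hp hr hlam hx hz hmin hD
  have ha := vecNorm_nonneg r hr (w - x)
  have hD0 : 0 ≤ D := (vecNorm_nonneg r hr _).trans hD
  rw [epiScale_powerProx hr hlam]
  set a := vecNorm r (w - x)
  have hL : 0 < lam ^ (-p) := by positivity
  set L := lam ^ (-p)
  have hp1 : 0 < p + 1 := by linarith
  have hyoung := weighted_young (p := p) (by linarith) ha (mul_nonneg ht hD0)
  rw [Real.mul_rpow ht hD0] at hyoung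
  have hap : a ^ p * a = a ^ (p + 1) := (Real.rpow_add_one' ha hp1.ne').symm
  have hap0 : 0 ≤ a ^ (p + 1) := by positivity
  have h1 : α - b + L / (p + 1) * a ^ (p + 1) ≤ L * (a ^ p * D) := by
    have : L / (p + 1) * a ^ (p + 1) ≤ L * a ^ (p + 1) := by
      gcongr
      exact div_le_self hL.le (by linarith)
    calc _ ≤ L * (a ^ p * (D - a)) + L * a ^ (p + 1) := by linarith
      _ = _ := by rw [← hap]; ring
  have h2 := mul_le_mul_of_nonneg_left h1 ht
  have h3 := mul_le_mul_of_nonneg_left hyoung (by positivity : 0 ≤ L / (p + 1))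
  have e3 : L / (p + 1) * ((p + 1) * (a ^ p * (t * D))) = t * (L * (a ^ p * D)) := by
    field_simp
  rw [e3] at h3
  nlinarith

end proxGap

/-! ### Bounded level sets and limit points -/

section convergence

variable {m : ℕ} {p r lam : ℝ} {ψ : EuclideanSpace ℝ (Fin m) → EReal}

/-- A bound on the envelope bounds ψ at the proximal point, hence that point, and also bounds F of
the displacement, hence `w` itself. -/
theorem IsGammaZero.exists_env_sublevel_radius (hψ : IsGammaZero ψ) (hp : 1 ≤ p) (hr : 1 ≤ r)
    (hlam : 0 < lam) {x : EuclideanSpace ℝ (Fin m)} (hx : x ∈ argminSet ψ)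
    (hb : Bornology.IsBounded (argminSet ψ)) (L : ℝ) :
    ∃ R : ℝ, ∀ w, anisoEnv lam (powerProx p r) ψ w ≤ (L : EReal) → ‖w - x‖ ≤ R := by
  obtain ⟨e, s, he, hs, hes, hmin⟩ := hψ.exists_real_env hp hr hlam
  obtain ⟨a, ha, b, hquad⟩ := exists_quadratic_le_epiScale_powerProx m hp hr hlam
  obtain ⟨R, hR⟩ := hψ.exists_sublevel_radius hx hb L
  obtain ⟨x0, hx0⟩ := hψ.proper
  obtain ⟨σ, hσ⟩ := hψ.exists_coe (ne_top_of_le_ne_top hx0 (hx x0))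
  refine ⟨R + ((L - σ + b) / a + 1), fun w hw => ?_⟩
  rw [he] at hw
  have hw : e w ≤ L := by exact_mod_cast hw
  set z := anisoProx lam (powerProx p r) ψ w
  have hF := epiScale_powerProx_nonneg hp hr hlam (w - z)
  have h1 : ‖z - x‖ ≤ R := hR z _ (hs w) (by linarith [hes w])
  have h2 : σ ≤ s w := by
    have := hx z
    rw [hσ, hs] at this
    exact_mod_cast this
  have h3 : ‖w - z‖ ^ 2 ≤ (L - σ + b) / a := by
    rw [le_div_iff₀ ha]
    linarith [hquad (w - z), hes w]
  have h4 : ‖w - x‖ ≤ ‖w - z‖ + ‖z - x‖ := norm_sub_le_norm_sub_add_norm_sub w z x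
  nlinarith [sq_nonneg (‖w - z‖ - 1)]

theorem IsGammaZero.bddAbove_levelDistances (hψ : IsGammaZero ψ) (hp : 1 ≤ p) (hr : 1 ≤ r)
    (hlam : 0 < lam) {x : EuclideanSpace ℝ (Fin m)} (hx : x ∈ argminSet ψ)
    (hb : Bornology.IsBounded (argminSet ψ)) (y0 : EuclideanSpace ℝ (Fin m)) (β : ℝ) :
    BddAbove (levelDistances p r lam ψ y0 x β) := by
  obtain ⟨e, s, he, hs, hes, hmin⟩ := hψ.exists_real_env hp hr hlam
  obtain ⟨R, hR⟩ := hψ.exists_env_sublevel_radius hp hr hlam hx hb (e y0 + β)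
  refine ((isCompact_closedBall x R).bddAbove_image
    (f := fun w => vecNorm r (x - w)) ?_).mono ?_
  · exact ((continuous_vecNorm hr).comp (by fun_prop)).continuousOn
  · rintro d ⟨w, hw, rfl⟩
    refine ⟨w, mem_closedBall_iff_norm.2 (hR w ?_), rfl⟩
    rw [he y0] at hw
    exact_mod_cast hw

/-- Limits of points whose distance to their proximal points vanishes are minimizers. -/
theorem IsGammaZero.mem_argminSet_of_tendsto (hψ : IsGammaZero ψ) (hp : 1 ≤ p) (hr : 1 ≤ r)
    (hlam : 0 < lam) {ι : Type*} {l : Filter ι} [l.NeBot] {y : ι → EuclideanSpace ℝ (Fin m)}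
    {x : EuclideanSpace ℝ (Fin m)} (hy : Tendsto y l (𝓝 x))
    (hv : Tendsto (fun k => vecNorm r (y k - anisoProx lam (powerProx p r) ψ (y k))) l (𝓝 0)) :
    x ∈ argminSet ψ := by
  obtain ⟨e, s, he, hs, hes, hmin⟩ := hψ.exists_real_env hp hr hlam
  obtain ⟨C, hC, hnorm⟩ := exists_norm_le_mul_vecNorm m hr
  have hsub : Tendsto (fun k => y k - anisoProx lam (powerProx p r) ψ (y k)) l (𝓝 0) :=
    squeeze_zero_norm (fun k => hnorm _) (by simpa using hv.const_mul C)
  have hprox : Tendsto (fun k => anisoProx lam (powerProx p r) ψ (y k)) l (𝓝 x) := by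
    simpa using hy.sub hsub
  have hcont : Continuous (epiScale lam (powerProx p r) : EuclideanSpace ℝ (Fin m) → ℝ) :=
    continuous_epiScale_powerProx hp hr hlam
  -- Passing to the limit in the minimality of the proximal points, by lower semicontinuity of ψ and
  -- continuity of F, shows that `x` is its own proximal point.
  have hle : ∀ v, ∀ c : ℝ, ψ v = c →
      ψ x ≤ ((c + epiScale lam (powerProx p r) (x - v) : ℝ) : EReal) := by
    intro v c hc
    refine EReal.le_of_forall_lt_iff_le.1 fun t ht => ?_
    by_contra! hlt
    have hlim : Tendsto (fun k => c + epiScale lam (powerProx p r) (y k - v)) l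
        (𝓝 (c + epiScale lam (powerProx p r) (x - v))) :=
      ((hcont.tendsto _).comp (hy.sub_const v)).const_add c
    have h1 := hprox.eventually (hψ.lsc x _ hlt)
    have h2 := hlim.eventually_lt_const (by exact_mod_cast ht)
    obtain ⟨k, hk1, hk2⟩ := (h1.and h2).exists
    rw [hs] at hk1
    have hk1 : t < s (y k) := by exact_mod_cast hk1
    have h3 := hmin (y k) v c hc
    have h4 := epiScale_powerProx_nonneg hp hr hlam
      (y k - anisoProx lam (powerProx p r) ψ (y k))
    linarith [hes (y k)]
  obtain ⟨x0, hx0⟩ := hψ.proper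
  obtain ⟨α0, hα0⟩ := hψ.exists_coe hx0
  obtain ⟨α, hα⟩ := hψ.exists_coe (ne_top_of_le_ne_top (EReal.coe_ne_top _) (hle x0 α0 hα0))
  refine fun z => hψ.le_of_coe fun b hz => ?_
  -- With `w = x` the displacement is zero, so the first-order estimate reduces to `ψ x ≤ ψ z`.
  have hgap := hψ.prox_gap_le (w := x) hp hr hlam hα hz (fun v c hc => by
    have := hle v c hc
    rw [hα] at this
    rw [sub_self, epiScale_powerProx_zero hp hr hlam, add_zero]
    exact_mod_cast this) le_rfl
  rw [sub_self, vecNorm_zero hr, Real.zero_rpow (by linarith), zero_mul, mul_zero] at hgap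
  rw [hα]
  exact_mod_cast sub_nonpos.1 hgap

theorem summable_const_div_rpow {p : ℝ} (hp : 1 ≤ p) (c : ℝ) :
    Summable fun k : ℕ => c / ((k : ℝ) + 1) ^ (p + 1) := by
  have h := (summable_nat_add_iff 1).2
    (Real.summable_one_div_nat_rpow.2 (by linarith : 1 < p + 1))
  refine (h.mul_left c).congr fun k => ?_
  push_cast
  ring

end convergence

/-! ### Assembly of the main theorem -/

theorem mainTheorem2 (m : ℕ) (p r lam : ℝ) (hp : 1 ≤ p) (hr : r = 2 ∨ r = p + 1)
    (hlam : 0 < lam)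
    (ψ : EuclideanSpace ℝ (Fin m) → EReal) (hψ : IsGammaZero ψ)
    (ε : ℕ → ℝ) (hε : ∀ k, 0 ≤ ε k)
    (y : ℕ → EuclideanSpace ℝ (Fin m))
    (hy : ∀ k, epiScale lam (powerProx p r)
      (y (k + 1) - anisoProx lam (powerProx p r) ψ (y k)) ≤ ε k) :
    -- the envelope is real-valued and the proximal point is well defined
    (∀ w, anisoEnv lam (powerProx p r) ψ w ≠ ⊥ ∧ anisoEnv lam (powerProx p r) ψ w ≠ ⊤ ∧
      argminSet (proxObjective lam (powerProx p r) ψ w) =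
        {anisoProx lam (powerProx p r) ψ w}) ∧
    -- decrease of the envelope up to `ε k`
    (∀ k, anisoEnv lam (powerProx p r) ψ (y (k + 1)) - anisoEnv lam (powerProx p r) ψ (y k) ≤
      ((-epiScale lam (powerProx p r) (y k - anisoProx lam (powerProx p r) ψ (y k)) + ε k : ℝ) :
        EReal)) ∧
    -- vanishing steps
    (Summable ε → (argminSet ψ).Nonempty →
      Tendsto (fun k => vecNorm r (y (k + 1) - y k)) atTop (𝓝 0)) ∧
    -- bounded solution set: bounded iterates, limit points are minimizers, rate
    ((argminSet ψ).Nonempty → Bornology.IsBounded (argminSet ψ) →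
      (Summable ε →
        Bornology.IsBounded (Set.range y) ∧
        ∀ x, MapClusterPt x atTop y → x ∈ argminSet ψ) ∧
      (∀ c : ℝ, 0 ≤ c → (∀ k : ℕ, ε k = c / ((k : ℝ) + 1) ^ (p + 1)) →
        Summable ε ∧
        ∀ ystar ∈ argminSet ψ,
          BddAbove (levelDistances p r lam ψ (y 0) ystar (∑' k, ε k)) ∧
          ∀ k : ℕ, 1 ≤ k →
            anisoEnv lam (powerProx p r) ψ (y k) - anisoEnv lam (powerProx p r) ψ ystar ≤
              (((lam ^ (-p) *
                    sSup (levelDistances p r lam ψ (y 0) ystar (∑' k, ε k)) ^ (p + 1) *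
                    (p ^ 2 + p) ^ p + c) / (k : ℝ) ^ p : ℝ) : EReal))) := by
  have hr1 : 1 ≤ r := by rcases hr with rfl | rfl <;> linarith
  obtain ⟨e, s, he, hs, hes, hmin⟩ := hψ.exists_real_env hp hr1 hlam
  set F := epiScale lam (powerProx p r) with hFdef
  have hF0 : ∀ x : EuclideanSpace ℝ (Fin m), 0 ≤ F x := epiScale_powerProx_nonneg hp hr1 hlam
  -- The old proximal point is a competitor in the envelope at the new iterate, at cost at most `ε
  -- k`.
  have hstep : ∀ k, e (y (k + 1)) ≤ s (y k) + ε k := fun k =>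
    (hmin (y (k + 1)) _ _ (hs (y k))).trans (by linarith [hy k])
  have hdecr : ∀ k, e (y (k + 1)) + F (y k - anisoProx lam (powerProx p r) ψ (y k)) ≤
      e (y k) + ε k := fun k => by linarith [hstep k, hes (y k)]
  have hlower : ∀ x ∈ argminSet ψ, ∃ σ : ℝ, ψ x = σ ∧ e x = σ ∧ ∀ w, σ ≤ s w ∧ σ ≤ e w := by
    intro x hx
    obtain ⟨σ, hσ⟩ := hψ.exists_coe (ne_top_of_le_ne_top (hs x ▸ EReal.coe_ne_top _) (hx _))
    have h1 : ∀ w, σ ≤ s w := fun w => by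
      have := hx (anisoProx lam (powerProx p r) ψ w)
      rw [hσ, hs] at this
      exact_mod_cast this
    have h2 : ∀ w, σ ≤ e w := fun w => by linarith [h1 w, hes w, hF0 (w - anisoProx lam
      (powerProx p r) ψ w)]
    have h3 := hmin x x σ hσ
    rw [sub_self, hFdef, epiScale_powerProx_zero hp hr1 hlam, add_zero] at h3
    exact ⟨σ, hσ, le_antisymm h3 (h2 x), fun w => ⟨h1 w, h2 w⟩⟩
  have htele : ∀ k, e (y k) + ∑ i ∈ Finset.range k,
      F (y i - anisoProx lam (powerProx p r) ψ (y i)) ≤ e (y 0) + ∑ i ∈ Finset.range k, ε i := by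
    intro k
    induction k with
    | zero => simp
    | succ k ih =>
      rw [Finset.sum_range_succ, Finset.sum_range_succ]
      linarith [hdecr k]
  have hlevel : Summable ε → ∀ k, e (y k) ≤ e (y 0) + ∑' k, ε k := fun hsum k => by
    have h1 := hsum.sum_le_tsum (Finset.range k) fun i _ => hε i
    have h2 : 0 ≤ ∑ i ∈ Finset.range k, F (y i - anisoProx lam (powerProx p r) ψ (y i)) :=
      Finset.sum_nonneg fun i _ => hF0 _
    linarith [htele k]
  have hgap : Summable ε → (argminSet ψ).Nonempty →
      Tendsto (fun k => vecNorm r (y k - anisoProx lam (powerProx p r) ψ (y k))) atTop (𝓝 0) := by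
    rintro hsum ⟨x, hx⟩
    obtain ⟨σ, -, -, hσ⟩ := hlower x hx
    have : Summable fun k => F (y k - anisoProx lam (powerProx p r) ψ (y k)) :=
      summable_of_sum_range_le (c := e (y 0) + ∑' k, ε k - σ) (fun k => hF0 _) fun k => by
        linarith [htele k, hsum.sum_le_tsum (Finset.range k) fun i _ => hε i, (hσ (y k)).2]
    exact tendsto_vecNorm_of_tendsto_epiScale hp hr1 hlam this.tendsto_atTop_zero
  refine ⟨fun w => ⟨?_, ?_, ?_⟩, fun k => ?_, fun hsum hne => ?_, fun hne hb => ⟨fun hsum =>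
    ⟨?_, fun x hx => ?_⟩, fun c hc hεc => ?_⟩⟩
  · rw [he]; exact EReal.coe_ne_bot _
  · rw [he]; exact EReal.coe_ne_top _
  · exact (hψ.argminSet_proxObjective_subsingleton hp hr hlam w).eq_singleton_of_mem
      (hψ.anisoProx_mem hp hr1 hlam w)
  · rw [he, he]
    norm_cast
    linarith [hdecr k]
  · have h1 : Tendsto (fun k => vecNorm r (y (k + 1) - anisoProx lam (powerProx p r) ψ (y k)))
        atTop (𝓝 0) := tendsto_vecNorm_of_tendsto_epiScale hp hr1 hlam
      (squeeze_zero (fun k => hF0 _) hy hsum.tendsto_atTop_zero)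
    refine squeeze_zero (fun k => vecNorm_nonneg r hr1 _) (fun k => ?_)
      (by simpa using h1.add (hgap hsum hne))
    rw [vecNorm_sub_comm hr1 (y k)]
    refine le_of_eq_of_le ?_ (vecNorm_add_le hr1 _ _)
    congr 1
    abel
  · obtain ⟨x, hx⟩ := hne
    obtain ⟨R, hR⟩ := hψ.exists_env_sublevel_radius hp hr1 hlam hx hb (e (y 0) + ∑' k, ε k)
    refine (Metric.isBounded_closedBall (x := x) (r := R)).subset ?_
    rintro _ ⟨k, rfl⟩
    refine mem_closedBall_iff_norm.2 (hR _ ?_)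
    rw [he]
    exact_mod_cast hlevel hsum k
  · obtain ⟨U, hU, hUx⟩ := mapClusterPt_iff_ultrafilter.1 hx
    exact hψ.mem_argminSet_of_tendsto hp hr1 hlam hUx ((hgap hsum hne).mono_left hU)
  · have hsum : Summable ε := (summable_const_div_rpow hp c).congr fun k => (hεc k).symm
    refine ⟨hsum, fun x hx => ?_⟩
    have hbdd := hψ.bddAbove_levelDistances hp hr1 hlam hx hb (y 0) (∑' k, ε k)
    refine ⟨hbdd, fun k hk => ?_⟩
    obtain ⟨σ, hσ, heσ, hσle⟩ := hlower x hx
    set D := sSup (levelDistances p r lam ψ (y 0) x (∑' k, ε k)) with hDdef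
    -- All iterates stay in the enlarged level set, so one `D` serves every step of the recursion.
    have hD : ∀ k, vecNorm r (y k - x) ≤ D := fun k => by
      rw [vecNorm_sub_comm hr1]
      refine le_csSup hbdd ⟨y k, ?_, rfl⟩
      rw [he, he]
      exact_mod_cast hlevel hsum k
    have hD0 : 0 ≤ D := (vecNorm_nonneg r hr1 _).trans (hD 0)
    have hrate := le_div_rpow_of_recursion (δ := fun k => e (y k) - σ) (c := c)
      (C := lam ^ (-p) / (p + 1) * p ^ p * D ^ (p + 1)) hp (by positivity) (fun k t ht => by
        have h1 := hψ.prox_decrease (w := y k) hp hr1 hlam (hs (y k)) hσ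
          (fun v b hv => hes (y k) ▸ hmin (y k) v b hv) (hD k) ht
        rw [← hes (y k)] at h1
        have h2 := hstep k
        rw [hεc k] at h2
        linarith) hk
    rw [he, he, heσ]
    norm_cast
    -- The constants agree: `p^p (p+1)^(p+1) / (p+1) = (p^2 + p)^p`.
    refine hrate.trans_eq ?_
    have hp1 : (0 : ℝ) < p + 1 := by linarith
    rw [show p ^ 2 + p = p * (p + 1) by ring, Real.mul_rpow (by linarith) hp1.le,
      Real.rpow_add_one hp1.ne' p]
    field_simp
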